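/- Let $G$ be a finite simple graph with vertex set $V$, let $k$ be a field, and let $R = k[x_v : v \in V]$. For $W \subseteq V$ let $G_W$ denote the induced subgraph of $G$ on $W$. Let $J \subseteq R$ be the cover ideal of $G$, that is, the ideal generated by the monomials $\prod_{v \in W} x_v$, where $W \subseteq V$ runs over the vertex covers of $G$. The graph $G$ is called perfect if $\chi(G_S) = \omega(G_S)$ for every $S \subseteq V$, where $\chi$ is the chromatic number and $\omega$ is the size of a largest clique. An ideal $I \subseteq R$ has the saturated chain property for associated primes if for every associated prime $P$ of $R/I$ that is not minimal there is an associated prime $Q \subsetneq P$ of $R/I$ with $\operatorname{height}(Q) = \operatorname{height}(P) - 1$. Then the following four conditions are equivalent: (1) $G$ is perfect; (2) for every integer $s \ge 1$ and every subset $P \subseteq V$, the ideal $(x_v : v \in P)$ lies in $\operatorname{Ass}(R/J^s)$ if and only if $G_P$ is a clique of size $r = |P|$ with $1 < r \le s+1$; (3) for every integer $s$ with $1 \le s < \chi(G)$ and every subset $P \subseteq V$, the ideal $(x_v : v \in P)$ lies in $\operatorname{Ass}(R/J^s)$ if and only if $G_P$ is a clique of size $r = |P|$ with $1 < r \le s+1$;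 (4) for every integer $s \ge 1$, the ideal $J^s$ has the saturated chain property for associated primes. -/

import Mathlib

namespace SimpleGraph

/-- A graph is perfect if every induced subgraph has chromatic number equal to the size of its
largest clique. -/
def IsPerfectGraph {V : Type*} (G : SimpleGraph V) : Prop :=
  ∀ S : Set V, (G.induce S).chromaticNumber = ((G.induce S).cliqueNum : ℕ∞)

/-- The cover ideal of `G` in `k[x_v : v ∈ V]`: it is generated by the squarefree monomials
`∏_{v ∈ W} x_v`, with `W` a vertex cover of `G`. -/
noncomputable def coverIdeal {V : Type*} (G : SimpleGraph V) (k : Type*) [Field k] :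
    Ideal (MvPolynomial V k) :=
  Ideal.span {m | ∃ W : Finset V, G.IsVertexCover (W : Set V) ∧ m = ∏ v ∈ W, MvPolynomial.X v}

end SimpleGraph

/-- The monomial prime `(x_v : v ∈ P)` of `k[x_v : v ∈ V]`. -/
noncomputable def monomialPrime {V : Type*} (k : Type*) [Field k] (P : Finset V) : Ideal (MvPolynomial V k) :=
  Ideal.span (MvPolynomial.X '' (P : Set V))

/-- The saturated chain property for associated primes: every associated prime `P` of `R ⧸ I` that
is not a minimal one properly contains an associated prime `Q` whose height is one less. -/
def Ideal.SaturatedChainProperty {R : Type*} [CommRing R] (I : Ideal R) : Prop :=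
  ∀ P ∈ associatedPrimes R (R ⧸ I), ¬ Minimal (· ∈ associatedPrimes R (R ⧸ I)) P →
    ∃ Q ∈ associatedPrimes R (R ⧸ I), Q < P ∧ Q.height + 1 = P.height

/-!
Write `J` for the cover ideal. Complements of vertex covers are independent sets, so a monomial `x^a`
lies in `J ^ s` exactly when `s` independent sets can be chosen that cover each vertex `v` at least
`s - a v` times: the weight `b = s - a` is `s`-multicolorable (`mem_coverIdeal_pow_iff`). Hence
`(x_v : v ∈ P)` is associated to `J ^ s` if and only if there is a weight `b ≤ s` supported on `P`
that is critical: not `s`-multicolorable, but becoming so when lowered at any vertex of `P`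
(`monomialPrime_mem_associatedPrimes_iff`). Every associated prime has this form
(`exists_eq_monomialPrime`).

A clique with `1 < |P| ≤ s + 1` always carries a critical weight, namely any positive weight of total
`s + 1`. Conversely, if the graph is perfect on `P`, then a weight on `P` that is not
`s`-multicolorable has a clique of weight at least `s + 1`, by the replication lemma of Lovász in
weighted form (`IsPerfectOn.isMulticolorable`), and criticality forces `P` to be contained in that
clique and to have total weight `s + 1`. So for perfect graphs the associated primes are as listed,
and removing one vertex at a time from a clique gives saturated chains.

If the graph is not perfect, take a minimal set `T` whose induced subgraph is not colorable with its
clique number `s` of colors. The indicator of `T` is critical, so `(x_v : v ∈ T)` is associated to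
`J ^ s` although `T` is not a clique, and `s` is less than the chromatic number. If it contained an
associated prime of height `|T| - 1`, then by perfection of the proper subsets of `T` some `|T| - 1`
vertices of `T` would form a clique, so `|T| - 1 ≤ s`; as two vertices of `T` are not adjacent, `T`
would be `s`-colorable.
-/

open MvPolynomial

namespace SimpleGraph

variable {V : Type*} [DecidableEq V] {G : SimpleGraph V}

/-! ### Multicolorings and the replication lemma -/

/-- `G.IsMulticolorable b s` says that `s` independent sets (repetitions allowed) can be chosen so
that every vertex `v` lies in at least `b v` of them. With `b` the indicator function of `T` this is
`s`-colorability of the subgraph induced on `T`. -/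
def IsMulticolorable (G : SimpleGraph V) (b : V → ℕ) (s : ℕ) : Prop :=
  ∃ I : Fin s → Finset V, (∀ j, G.IsIndepSet (I j : Set V)) ∧
    ∀ v, b v ≤ ∑ j, if v ∈ I j then 1 else 0

theorem IsMulticolorable.mono {b c : V → ℕ} {s : ℕ} (h : G.IsMulticolorable c s)
    (hbc : ∀ v, b v ≤ c v) : G.IsMulticolorable b s := by
  obtain ⟨I, hI, hc⟩ := h
  exact ⟨I, hI, fun v => (hbc v).trans (hc v)⟩

theorem IsMulticolorable.cons {b c : V → ℕ} {s : ℕ} (h : G.IsMulticolorable c s) {A : Finset V}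
    (hA : G.IsIndepSet (A : Set V)) (hbc : ∀ v, b v ≤ (if v ∈ A then 1 else 0) + c v) :
    G.IsMulticolorable b (s + 1) := by
  obtain ⟨I, hI, hc⟩ := h
  refine ⟨Fin.cons A I, fun j => ?_, fun v => ?_⟩
  · refine Fin.cases ?_ (fun i => ?_) j
    · simpa using hA
    · simpa using hI i
  · rw [Fin.sum_univ_succ]
    simpa using (hbc v).trans (Nat.add_le_add_left (hc v) _)

/-- An independent set meets a clique in at most one vertex, so the total weight of a clique is
at most the number of colors. -/
theorem IsMulticolorable.sum_le {b : V → ℕ} {s : ℕ} (h : G.IsMulticolorable b s) {K : Finset V}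
    (hK : G.IsClique (K : Set V)) : ∑ v ∈ K, b v ≤ s := by
  obtain ⟨I, hI, hb⟩ := h
  calc ∑ v ∈ K, b v ≤ ∑ v ∈ K, ∑ j, (if v ∈ I j then 1 else 0) :=
        Finset.sum_le_sum fun v _ => hb v
    _ = ∑ j, ∑ v ∈ K, (if v ∈ I j then 1 else 0) := Finset.sum_comm
    _ ≤ ∑ _j : Fin s, 1 := by
        refine Finset.sum_le_sum fun j _ => ?_
        rw [← Finset.card_filter, Finset.card_le_one]
        intro x hx y hy
        rw [Finset.mem_filter] at hx hy
        by_contra hne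
        exact hI j hx.2 hy.2 hne (hK hx.1 hy.1 hne)
    _ = s := by simp

/-- In any graph, singletons suffice as color classes for a weight of total at most `s`. -/
theorem isMulticolorable_of_sum_le {b : V → ℕ} {P : Finset V} :
    ∀ {s : ℕ}, (∀ v ∉ P, b v = 0) → ∑ v ∈ P, b v ≤ s → G.IsMulticolorable b s := by
  intro s
  induction s generalizing b with
  | zero =>
    intro h0 hs
    refine ⟨fun _ => ∅, fun j => j.elim0, fun v => ?_⟩
    by_cases hv : v ∈ P
    · simpa using (Finset.sum_eq_zero_iff.1 (Nat.le_zero.1 hs)) v hv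
    · simp [h0 v hv]
  | succ n ih =>
    intro h0 hs
    by_cases hx : ∃ x ∈ P, b x ≠ 0
    · obtain ⟨x, hxP, hx⟩ := hx
      refine (ih (b := fun v => b v - if v ∈ ({x} : Finset V) then 1 else 0)
        (fun v hv => by simp [h0 v hv]) ?_).cons (A := {x}) (by simp [IsIndepSet])
        (fun v => by omega)
      refine Nat.lt_succ_iff.1 (lt_of_lt_of_le (Finset.sum_lt_sum (fun v _ => Nat.sub_le _ _)
        ⟨x, hxP, ?_⟩) hs)
      simp only [Finset.mem_singleton, if_true]
      omega
    · push Not at hx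
      refine ⟨fun _ => ∅, fun j => by simp [IsIndepSet], fun v => ?_⟩
      by_cases hv : v ∈ P
      · simp [hx v hv]
      · simp [h0 v hv]

theorem isMulticolorable_indicator_iff {T : Finset V} {s : ℕ} :
    G.IsMulticolorable (fun v => if v ∈ T then 1 else 0) s ↔
      (G.induce (T : Set V)).Colorable s := by
  constructor
  · rintro ⟨I, hI, hb⟩
    have hex : ∀ v : (T : Set V), ∃ j, (v : V) ∈ I j := by
      intro v
      by_contra! hv
      have := hb v
      have hvT : (v : V) ∈ T := v.2
      simp [hv, hvT] at this
    choose c hc using hex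
    refine ⟨Coloring.mk c fun {v w} hvw heq => ?_⟩
    exact hI (c v) (hc v) (heq ▸ hc w) (Subtype.coe_ne_coe.2 hvw.ne) hvw
  · rintro ⟨C⟩
    refine ⟨fun j => {v ∈ T | ∃ h : v ∈ T, C ⟨v, h⟩ = j}, fun j => ?_, fun v => ?_⟩
    · intro v hv w hw _ hvw
      simp only [Finset.coe_filter, Set.mem_ofPred_eq] at hv hw
      obtain ⟨_, hv, hvj⟩ := hv
      obtain ⟨_, hw, hwj⟩ := hw
      exact C.valid (v := ⟨v, hv⟩) (w := ⟨w, hw⟩) hvw (hvj.trans hwj.symm)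
    · dsimp only
      split_ifs with hv
      · refine le_trans ?_ (Finset.single_le_sum (fun _ _ => Nat.zero_le _)
          (Finset.mem_univ (C ⟨v, hv⟩)))
        simp [hv]
      · exact Nat.zero_le _

/-- Perfection of the subgraph induced on `S`, in terms of multicolorings: every `T ⊆ S` is
colorable with any number of colors that bounds the sizes of the cliques in `T`. -/
def IsPerfectOn (G : SimpleGraph V) (S : Finset V) : Prop :=
  ∀ T ⊆ S, ∀ n, (∀ K ⊆ T, G.IsClique (K : Set V) → K.card ≤ n) →
    G.IsMulticolorable (fun v => if v ∈ T then 1 else 0) n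

/-- The weighted form of Lovász's replication lemma: on a perfect graph, a weight is
`s`-multicolorable as soon as no clique has weight more than `s`. -/
theorem IsPerfectOn.isMulticolorable [Fintype V] {S : Finset V} (hS : G.IsPerfectOn S)
    (b : V → ℕ) (hb : ∀ v ∉ S, b v = 0) (s : ℕ)
    (h : ∀ K : Finset V, G.IsClique (K : Set V) → ∑ v ∈ K, b v ≤ s) :
    G.IsMulticolorable b s := by
  induction hn : ∑ v, b v using Nat.strong_induction_on generalizing b s with
  | _ n ih =>
  subst hn
  by_cases hb1 : ∀ v, b v ≤ 1
  · refine (hS {v ∈ S | b v ≠ 0} (Finset.filter_subset _ _) s fun K hK hKc => ?_).mono fun v => ?_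
    · refine le_trans ?_ (h K hKc)
      rw [Finset.card_eq_sum_ones]
      refine Finset.sum_le_sum fun v hv => Nat.one_le_iff_ne_zero.2 ?_
      exact (Finset.mem_filter.1 (hK hv)).2
    · by_cases hv : b v = 0
      · simp [hv]
      · have : v ∈ S := by
          by_contra hvS
          exact hv (hb v hvS)
        simpa [this, hv] using hb1 v
  · push Not at hb1
    obtain ⟨x, hx⟩ := hb1
    have hle : ∀ v, Function.update b x (b x - 1) v ≤ b v := fun v => by
      by_cases hv : v = x
      · subst hv; simp
      · simp [hv]
    -- Color the weight with one copy of `x` removed, and pick a color class containing `x`.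
    obtain ⟨I, hI, hIb⟩ := ih _ (Finset.sum_lt_sum (fun v _ => hle v)
      ⟨x, Finset.mem_univ x, by simp; omega⟩) (Function.update b x (b x - 1))
      (fun v hv => Nat.le_zero.1 ((hle v).trans (hb v hv).le)) s
      (fun K hK => (Finset.sum_le_sum fun v _ => hle v).trans (h K hK)) rfl
    have hxj : ∃ j, x ∈ I j := by
      by_contra! hxj
      have := hIb x
      simp [hxj] at this
      omega
    obtain ⟨j, hj⟩ := hxj
    obtain ⟨m, rfl⟩ : ∃ m, s = m + 1 := ⟨s - 1, by have := j.2; omega⟩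
    have hrem : G.IsMulticolorable
        (fun v => Function.update b x (b x - 1) v - if v ∈ I j then 1 else 0) m := by
      refine ⟨fun i => I (j.succAbove i), fun i => hI _, fun v => ?_⟩
      have := hIb v
      rw [Fin.sum_univ_succAbove _ j] at this
      exact Nat.sub_le_iff_le_add'.2 this
    -- Removing this class from `b` itself lowers the clique bound by one, as either `x ∈ K`, or
    -- `b` agrees on `K` with the reduced weight.
    refine (ih _ (Finset.sum_lt_sum (fun v _ => Nat.sub_le _ _)
      ⟨x, Finset.mem_univ x, ?_⟩) (fun v => b v - if v ∈ I j then 1 else 0)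
      (fun v hv => by simp [hb v hv]) m (fun K hK => ?_) rfl).cons (hI j) fun v => by omega
    · simp only [hj, if_true]; omega
    · by_cases hxK : x ∈ K
      · refine Nat.lt_succ_iff.1 (lt_of_lt_of_le (Finset.sum_lt_sum (fun v _ => Nat.sub_le _ _)
          ⟨x, hxK, ?_⟩) (h K hK))
        simp only [hj, if_true]; omega
      · refine le_trans (Finset.sum_le_sum fun v hv => ?_) (hrem.sum_le hK)
        have : v ≠ x := fun h => hxK (h ▸ hv)
        simp [this]

theorem IsPerfectGraph.isPerfectOn [Finite V] (hG : G.IsPerfectGraph) (S : Finset V) :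
    G.IsPerfectOn S := by
  intro T _ n hn
  rw [isMulticolorable_indicator_iff, ← chromaticNumber_le_iff_colorable, hG]
  obtain ⟨K, hK⟩ := (G.induce (T : Set V)).exists_isNClique_cliqueNum
  rw [← hK.card_eq, ← Finset.card_map (Function.Embedding.subtype _), Nat.cast_le]
  refine hn _ ?_ ?_
  · intro v hv
    obtain ⟨w, _, rfl⟩ := Finset.mem_map.1 hv
    exact w.2
  · have := hK.isClique.map (f := Function.Embedding.subtype (· ∈ (T : Set V)))
    rw [Finset.coe_map]
    exact this.mono (map_comap_le _ _)

/-- A minimal witness of imperfection: a set `T` that is not `ω`-colorable, where `ω` bounds the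
sizes of the cliques in `T`, although all its proper subsets induce perfect subgraphs. -/
theorem exists_minimal_of_not_isPerfectGraph [Finite V] (hG : ¬ G.IsPerfectGraph) :
    ∃ (T : Finset V) (n : ℕ), (∀ K ⊆ T, G.IsClique (K : Set V) → K.card ≤ n) ∧
      ¬ G.IsMulticolorable (fun v => if v ∈ T then 1 else 0) n ∧
      ∀ S ⊂ T, G.IsPerfectOn S := by
  classical
  have hex : ∃ T : Finset V, ¬ G.IsPerfectOn T := by
    by_contra! hall
    refine hG fun S => ?_
    cases nonempty_fintype V
    refine le_antisymm ?_ cliqueNum_le_chromaticNumber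
    rw [chromaticNumber_le_iff_colorable]
    have := hall S.toFinset S.toFinset subset_rfl (G.induce S).cliqueNum fun K hK hKc => ?_
    · rw [isMulticolorable_indicator_iff] at this
      rwa [Set.coe_toFinset] at this
    · have hcl : (G.induce S).IsClique ((K.subtype (· ∈ S) : Finset S) : Set S) := by
        intro v hv w hw hne
        exact hKc (Finset.mem_subtype.1 hv) (Finset.mem_subtype.1 hw) fun h => hne (Subtype.ext h)
      refine le_trans (le_of_eq ?_) (IsClique.card_le_cliqueNum (tc := hcl))
      rw [Finset.card_subtype, Finset.filter_true_of_mem]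
      exact fun v hv => Set.mem_toFinset.1 (hK hv)
  obtain ⟨T, hT⟩ := exists_minimal_of_wellFoundedLT _ hex
  have hmin : ∀ S ⊂ T, G.IsPerfectOn S := fun S hST => by
    by_contra hS
    exact hT.not_prop_of_lt hST hS
  have hT' := hT.prop
  unfold IsPerfectOn at hT'
  push Not at hT'
  obtain ⟨U, hUT, n, hn, hU⟩ := hT'
  obtain rfl : U = T := by
    by_contra hne
    exact hU (hmin U (hUT.ssubset_of_ne hne) U subset_rfl n hn)
  exact ⟨U, n, hn, hU, hmin⟩

end SimpleGraph

/-! ### Associated primes of monomial ideals -/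

theorem Ideal.mem_associatedPrimes_quotient_iff {R : Type*} [CommRing R] [IsNoetherianRing R]
    {I Q : Ideal R} :
    Q ∈ associatedPrimes R (R ⧸ I) ↔ Q.IsPrime ∧ ∃ f, ∀ g, g ∈ Q ↔ g * f ∈ I := by
  rw [AssociatedPrimes.mem_iff, isAssociatedPrime_iff]
  refine and_congr_right fun _ => ?_
  rw [Ideal.Quotient.mk_surjective.exists]
  refine exists_congr fun f => ?_
  rw [Ideal.ext_iff]
  refine forall_congr' fun g => ?_
  rw [Submodule.mem_colon_singleton, Submodule.mem_bot,
    ← Ideal.Quotient.eq_zero_iff_mem (a := g * f), map_mul]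
  rfl

section

variable {V : Type*} {k : Type*} [Field k]

theorem mem_monomialPrime_iff {P : Finset V} {f : MvPolynomial V k} :
    f ∈ monomialPrime k P ↔ ∀ a ∈ f.support, ∃ v ∈ P, a v ≠ 0 := by
  simp [monomialPrime, mem_ideal_span_X_image]

theorem X_mem_monomialPrime_iff {P : Finset V} {v : V} :
    (X v : MvPolynomial V k) ∈ monomialPrime k P ↔ v ∈ P := by
  classical
  rw [mem_monomialPrime_iff, support_X]
  simp [Finsupp.single_apply]

theorem monomialPrime_le_iff {P Q : Finset V} :
    monomialPrime k P ≤ monomialPrime k Q ↔ P ⊆ Q := by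
  refine ⟨fun h v hv => X_mem_monomialPrime_iff.1 (h (X_mem_monomialPrime_iff (k := k).2 hv)),
    fun h => Ideal.span_mono (Set.image_mono h)⟩

theorem monomialPrime_lt_iff {P Q : Finset V} :
    monomialPrime k P < monomialPrime k Q ↔ P ⊂ Q := by
  rw [lt_iff_le_not_ge, monomialPrime_le_iff, monomialPrime_le_iff, Finset.ssubset_def]

/-- `(x_v : v ∈ P)` is the kernel of the substitution `x_v ↦ 0` for `v ∈ P`. -/
theorem monomialPrime_isPrime (P : Finset V) : (monomialPrime k P).IsPrime := by
  classical
  let φ : MvPolynomial V k →ₐ[k] MvPolynomial V k := aeval fun v => if v ∈ P then 0 else X v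
  have hmk : (Ideal.Quotient.mkₐ k (monomialPrime k P)).comp φ =
      Ideal.Quotient.mkₐ k (monomialPrime k P) := by
    refine MvPolynomial.algHom_ext fun v => ?_
    by_cases hv : v ∈ P
    · have : (X v : MvPolynomial V k) ∈ monomialPrime k P := X_mem_monomialPrime_iff.2 hv
      simpa [φ, hv] using (Ideal.Quotient.eq_zero_iff_mem.2 this).symm
    · simp [φ, hv]
  have hker : monomialPrime k P = RingHom.ker φ := by
    refine le_antisymm (Ideal.span_le.2 ?_) fun f hf => ?_
    · rintro _ ⟨v, hv, rfl⟩
      have hv' : v ∈ P := hv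
      simp [φ, hv']
    · rw [← Ideal.Quotient.eq_zero_iff_mem]
      have := DFunLike.congr_fun hmk f
      rw [AlgHom.comp_apply, (RingHom.mem_ker).1 hf, map_zero] at this
      exact this.symm
  rw [hker]
  exact RingHom.ker_isPrime _

theorem monomialPrime_height [Finite V] (P : Finset V) :
    (monomialPrime k P).height = P.card := by
  classical
  refine le_antisymm ?_ ?_
  · have hp := monomialPrime_isPrime (k := k) P
    have := Ideal.height_le_card_of_mem_minimalPrimes_span_finset (p := monomialPrime k P)
      (s := P.image X) (by
        rw [Finset.coe_image]
        change monomialPrime k P ∈ (monomialPrime k P).minimalPrimes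
        rw [Ideal.minimalPrimes_eq_subsingleton_self]
        rfl)
    exact this.trans (by exact_mod_cast Finset.card_image_le)
  · induction P using Finset.induction_on with
    | empty => simp
    | insert v P hv ih =>
      have hp := monomialPrime_isPrime (k := k) P
      have hp' := monomialPrime_isPrime (k := k) (insert v P)
      have := Ideal.height_add_one_le_of_lt_of_isPrime
        (monomialPrime_lt_iff (k := k).2 (Finset.ssubset_insert hv))
      rw [Finset.card_insert_of_notMem hv]
      push_cast
      exact (add_le_add_left ih 1).trans this

/-- Associated primes of a monomial ideal `I` are generated by variables. If `Q = (I : f)` with `f`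
having as few terms as possible and some `g ∈ Q` had no term divisible by a variable of `Q`, then a
product `n m` of terms of `g` and `f` that occurs uniquely in `g f` would lie in `I`. As the monomial
`n` is not in `Q`, also `Q = (I : n f)`, and `n f` may be shortened by its term `n m`. -/
theorem exists_eq_monomialPrime [Finite V] {E : Set (V →₀ ℕ)} {Q : Ideal (MvPolynomial V k)}
    (hQ : Q ∈ associatedPrimes (MvPolynomial V k)
      (MvPolynomial V k ⧸ Ideal.span ((fun a => monomial a (1 : k)) '' E))) :
    ∃ P : Finset V, Q = monomialPrime k P := by
  classical
  cases nonempty_fintype V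
  set I := Ideal.span ((fun a => monomial a (1 : k)) '' E) with hI
  have hmem : ∀ f : MvPolynomial V k, f ∈ I ↔ ∀ a ∈ f.support, ∃ e ∈ E, e ≤ a :=
    fun f => mem_ideal_span_monomial_image
  rw [Ideal.mem_associatedPrimes_quotient_iff] at hQ
  obtain ⟨hprime, hf⟩ := hQ
  obtain ⟨f, hf, hmin⟩ := exists_minimalFor_of_wellFoundedLT
    (fun f : MvPolynomial V k => ∀ g, g ∈ Q ↔ g * f ∈ I) (fun f => f.support.card) hf
  let P : Finset V := {v | (X v : MvPolynomial V k) ∈ Q}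
  have hP : ∀ v, v ∈ P ↔ (X v : MvPolynomial V k) ∈ Q := fun v => by simp [P]
  have hPQ : monomialPrime k P ≤ Q := by
    refine Ideal.span_le.2 ?_
    rintro _ ⟨v, hv, rfl⟩
    exact (hP v).1 hv
  refine ⟨P, le_antisymm (fun g hg => ?_) hPQ⟩
  -- Split `g` into its terms with and without variables from `P`.
  let g₁ : MvPolynomial V k := ∑ a ∈ g.support with ∃ v ∈ P, a v ≠ 0, monomial a (coeff a g)
  let g₀ : MvPolynomial V k := ∑ a ∈ g.support with ¬ ∃ v ∈ P, a v ≠ 0, monomial a (coeff a g)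
  have hsplit : g = g₁ + g₀ := by
    conv_lhs => rw [g.as_sum]
    exact (Finset.sum_filter_add_sum_filter_not _ _ _).symm
  have hg₁ : g₁ ∈ monomialPrime k P := by
    refine Ideal.sum_mem _ fun a ha => mem_monomialPrime_iff.2 fun c hc => ?_
    rw [Finset.mem_singleton.1 (support_monomial_subset hc)]
    exact (Finset.mem_filter.1 ha).2
  have hg₀ : g₀ ∈ Q := by
    have := Q.sub_mem hg (hPQ hg₁)
    rwa [hsplit, add_sub_cancel_left] at this
  have hsupp : ∀ a ∈ g₀.support, ∀ v ∈ P, a v = 0 := by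
    intro a ha
    obtain ⟨c, hc, hac⟩ := Finset.mem_biUnion.1 (support_sum ha)
    rw [Finset.mem_singleton.1 (support_monomial_subset hac)]
    simpa using (Finset.mem_filter.1 hc).2
  suffices h0 : g₀ = 0 by rwa [hsplit, h0, add_zero]
  by_contra h0
  have hf0 : f ≠ 0 := by
    rintro rfl
    exact hprime.ne_top (Ideal.eq_top_iff_one _ |>.2 ((hf 1).2 (by simp)))
  obtain ⟨n, hn, m, hm, huniq⟩ := UniqueSums.uniqueAdd_of_nonempty
    (support_nonempty.2 h0) (support_nonempty.2 hf0)
  have hcoeff : coeff (n + m) (g₀ * f) = coeff n g₀ * coeff m f :=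
    AddMonoidAlgebra.coeff_mul_add_of_uniqueAdd huniq
  have hnm : ∃ e ∈ E, e ≤ n + m := by
    refine (hmem _).1 ((hf g₀).1 hg₀) _ ?_
    rw [mem_support_iff, hcoeff]
    exact mul_ne_zero (mem_support_iff.1 hn) (mem_support_iff.1 hm)
  have hnQ : monomial n (1 : k) ∉ Q := by
    intro hnQ
    rw [monomial_eq, C_1, one_mul, Finsupp.prod, hprime.prod_mem_iff] at hnQ
    obtain ⟨v, hv, hvQ⟩ := hnQ
    exact (Finsupp.mem_support_iff.1 hv)
      (hsupp n hn v ((hP v).2 (hprime.mem_of_pow_mem _ hvQ)))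
  -- Multiplication by the monomial `n` is bijective on terms, so erasing `m` from `f` first
  -- removes the term `n m` of `n f`.
  have hrest : monomial m (coeff m f) * monomial n (1 : k) ∈ I := by
    rw [monomial_mul, hmem]
    intro a ha
    rw [Finset.mem_singleton.1 (support_monomial_subset ha), add_comm]
    exact hnm
  let f' := f - monomial m (coeff m f)
  have hf'supp : f'.support ⊆ f.support.erase m := by
    intro a ha
    rw [mem_support_iff, coeff_sub, coeff_monomial] at ha
    by_cases ham : m = a
    · subst ham
      simp at ha
    · rw [if_neg ham, sub_zero] at ha
      exact Finset.mem_erase.2 ⟨Ne.symm ham, mem_support_iff.2 ha⟩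
  have hf' : ∀ g, g ∈ Q ↔ g * (f' * monomial n 1) ∈ I := by
    intro g
    have h1 : g * (f' * monomial n 1) =
        g * monomial n 1 * f - g * (monomial m (coeff m f) * monomial n 1) := by
      simp only [f']; ring
    rw [h1, Submodule.sub_mem_iff_left I (I.mul_mem_left _ hrest), ← hf]
    exact ⟨fun h => Q.mul_mem_right _ h, fun h => (hprime.mem_or_mem h).resolve_right hnQ⟩
  have hlt : (f' * monomial n 1).support.card < f.support.card := by
    refine lt_of_le_of_lt ?_ (Finset.card_erase_lt_of_mem hm)
    refine le_trans (Finset.card_le_card (support_mul _ _)) ?_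
    refine le_trans (Finset.card_le_card (Finset.add_subset_add hf'supp
      support_monomial_subset)) ?_
    rw [Finset.add_singleton]
    exact Finset.card_image_le
  exact absurd (hmin hf' hlt.le) (not_le.2 hlt)

end

/-! ### Powers of the cover ideal -/

namespace SimpleGraph

variable {V : Type*} {G : SimpleGraph V} {k : Type*} [Field k]

/-- The exponents of the products of `s` monomials of vertex covers. -/
def coverExponents (G : SimpleGraph V) (s : ℕ) : Set (V →₀ ℕ) :=
  {a | ∃ W : Fin s → Finset V, (∀ j, G.IsVertexCover (W j : Set V)) ∧
    a = ∑ j, ∑ v ∈ W j, Finsupp.single v 1}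

theorem coverIdeal_eq_span : G.coverIdeal k = Ideal.span ((fun a => monomial a (1 : k)) ''
    {a | ∃ W : Finset V, G.IsVertexCover (W : Set V) ∧ a = ∑ v ∈ W, Finsupp.single v 1}) := by
  unfold coverIdeal
  congr 1
  ext m
  have hX : ∀ W : Finset V, ∏ v ∈ W, (X v : MvPolynomial V k) =
      monomial (∑ v ∈ W, Finsupp.single v 1) 1 := fun W => (monomial_sum_one W _).symm
  constructor
  · rintro ⟨W, hW, rfl⟩
    exact ⟨_, ⟨W, hW, rfl⟩, (hX W).symm⟩
  · rintro ⟨_, ⟨W, hW, rfl⟩, rfl⟩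
    exact ⟨W, hW, (hX W).symm⟩

theorem coverIdeal_pow_eq_span (s : ℕ) : G.coverIdeal k ^ s =
    Ideal.span ((fun a => monomial a (1 : k)) '' G.coverExponents s) := by
  induction s with
  | zero =>
    rw [pow_zero, Ideal.one_eq_top, eq_comm, Ideal.eq_top_iff_one]
    exact Ideal.subset_span ⟨0, ⟨fun j => j.elim0, fun j => j.elim0, by simp⟩, rfl⟩
  | succ n ih =>
    rw [pow_succ', ih, coverIdeal_eq_span, Ideal.span_mul_span']
    congr 1
    ext m
    rw [Set.mem_mul]
    constructor
    · rintro ⟨_, ⟨_, ⟨W, hW, rfl⟩, rfl⟩, _, ⟨_, ⟨U, hU, rfl⟩, rfl⟩, rfl⟩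
      refine ⟨_, ⟨Fin.cons W U, fun j => ?_, rfl⟩, ?_⟩
      · refine Fin.cases ?_ (fun i => ?_) j
        · simpa using hW
        · simpa using hU i
      · simp [Fin.sum_univ_succ, monomial_mul]
    · rintro ⟨_, ⟨W, hW, rfl⟩, rfl⟩
      refine ⟨_, ⟨_, ⟨W 0, hW 0, rfl⟩, rfl⟩, _,
        ⟨_, ⟨fun j => W j.succ, fun j => hW _, rfl⟩, rfl⟩, ?_⟩
      simp [Fin.sum_univ_succ, monomial_mul]

/-- Passing from vertex covers to their complements, `x^a` is divisible by a product of `s` cover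
monomials if and only if the weight `s - a` (truncated at `0`) is `s`-multicolorable. -/
theorem exists_coverExponents_le_iff [Fintype V] [DecidableEq V] {s : ℕ} {a : V →₀ ℕ} :
    (∃ e ∈ G.coverExponents s, e ≤ a) ↔ G.IsMulticolorable (fun v => s - a v) s := by
  have happly : ∀ (W : Fin s → Finset V) (v : V),
      (∑ j, ∑ u ∈ W j, Finsupp.single u 1 : V →₀ ℕ) v = ∑ j, if v ∈ W j then 1 else 0 := by
    intro W v
    simp [Finsupp.finsetSum_apply, Finsupp.single_apply]
  have hcompl : ∀ (W : Fin s → Finset V) (v : V),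
      (∑ j, if v ∈ W j then 1 else 0) + (∑ j, if v ∈ (W j)ᶜ then 1 else 0) = s := by
    intro W v
    rw [← Finset.sum_add_distrib]
    refine (Finset.sum_congr rfl fun j _ => ?_).trans (by simp : ∑ _j : Fin s, 1 = s)
    by_cases h : v ∈ W j <;> simp [h]
  constructor
  · rintro ⟨_, ⟨W, hW, rfl⟩, hle⟩
    refine ⟨fun j => (W j)ᶜ, fun j => ?_, fun v => ?_⟩
    · rw [Finset.coe_compl]
      exact isIndepSet_compl_iff_isVertexCover.2 (hW j)
    · have h1 := hle v
      rw [happly] at h1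
      have h2 := hcompl W v
      dsimp only
      omega
  · rintro ⟨I, hI, hle⟩
    refine ⟨_, ⟨fun j => (I j)ᶜ, fun j => ?_, rfl⟩, fun v => ?_⟩
    · rw [Finset.coe_compl]
      exact isVertexCover_compl.2 (hI j)
    · rw [happly]
      have h1 := hle v
      have h2 := hcompl I v
      dsimp only at h1
      omega

theorem mem_coverIdeal_pow_iff [Fintype V] [DecidableEq V] {s : ℕ} {f : MvPolynomial V k} :
    f ∈ G.coverIdeal k ^ s ↔ ∀ a ∈ f.support, G.IsMulticolorable (fun v => s - a v) s := by
  rw [coverIdeal_pow_eq_span, mem_ideal_span_monomial_image]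
  exact forall₂_congr fun a _ => exists_coverExponents_le_iff

/-- Associated primes of `J ^ s` in terms of critical weights: `(J ^ s : x^a)` is generated by the
variables in `P` when `b = s - a` vanishes off `P` and is not `s`-multicolorable, but becomes so when
lowered at any vertex of `P`. -/
theorem monomialPrime_mem_associatedPrimes_iff [Fintype V] [DecidableEq V] {s : ℕ}
    {P : Finset V} :
    monomialPrime k P ∈
        associatedPrimes (MvPolynomial V k) (MvPolynomial V k ⧸ G.coverIdeal k ^ s) ↔
      ∃ b : V → ℕ, (∀ v, b v ≤ s) ∧ (∀ v ∉ P, b v = 0) ∧ ¬ G.IsMulticolorable b s ∧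
        ∀ v ∈ P, G.IsMulticolorable (fun u => b u - if u = v then 1 else 0) s := by
  rw [Ideal.mem_associatedPrimes_quotient_iff]
  constructor
  · rintro ⟨-, f, hf⟩
    -- `x^n` lies outside the prime, so some term `m` of `f` has `x^(n + m) ∉ J ^ s`.
    let n : V →₀ ℕ := Finsupp.equivFunOnFinite.symm fun v => if v ∈ P then 0 else s
    have hn : ∀ v, n v = if v ∈ P then 0 else s := fun v => rfl
    have hnf : monomial n (1 : k) * f ∉ G.coverIdeal k ^ s := by
      rw [← hf, mem_monomialPrime_iff]
      intro h
      obtain ⟨v, hv, hnv⟩ := h n (by simp)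
      simp [hn, hv] at hnv
    rw [mem_coverIdeal_pow_iff] at hnf
    push Not at hnf
    obtain ⟨a, ha, hna⟩ := hnf
    rw [mem_support_iff, coeff_monomial_mul', one_mul] at ha
    split_ifs at ha with hle
    swap
    · exact absurd rfl ha
    refine ⟨fun v => s - a v, fun v => Nat.sub_le _ _, fun v hv => ?_, hna, fun v hv => ?_⟩
    · have := hle v
      rw [hn, if_neg hv] at this
      exact Nat.sub_eq_zero_of_le this
    · have hXf : X v * (monomial n 1 * f) ∈ G.coverIdeal k ^ s := by
        rw [mul_left_comm]
        exact Ideal.mul_mem_left _ _ ((hf _).1 (X_mem_monomialPrime_iff.2 hv))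
      rw [mem_coverIdeal_pow_iff] at hXf
      refine (hXf (Finsupp.single v 1 + a) ?_).mono fun u => ?_
      · rw [mem_support_iff, coeff_X_mul, coeff_monomial_mul', if_pos hle, one_mul]
        exact ha
      · rw [Finsupp.add_apply, Finsupp.single_apply]
        by_cases huv : u = v
        · subst huv
          simp only [if_true]
          omega
        · simp only [if_neg huv, if_neg (Ne.symm huv)]
          omega
  · rintro ⟨b, hbs, hbP, hb, hbv⟩
    let a : V →₀ ℕ := Finsupp.equivFunOnFinite.symm fun v => s - b v
    have ha : ∀ v, a v = s - b v := fun v => rfl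
    refine ⟨monomialPrime_isPrime P, monomial a 1, fun g => ?_⟩
    rw [mem_coverIdeal_pow_iff, mem_monomialPrime_iff]
    constructor
    · intro hg c hc
      rw [mem_support_iff, coeff_mul_monomial', mul_one] at hc
      split_ifs at hc with hac
      swap
      · exact absurd rfl hc
      obtain ⟨v, hv, hcv⟩ := hg (c - a) (mem_support_iff.2 hc)
      refine (hbv v hv).mono fun u => ?_
      have h1 := hac u
      have h2 := hbs u
      rw [ha] at h1
      by_cases huv : u = v
      · subst huv
        rw [Finsupp.tsub_apply, ha] at hcv
        simp only [if_true]
        omega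
      · rw [if_neg huv]
        omega
    · intro hg c hc
      by_contra! hcP
      refine hb ((hg (c + a) ?_).mono fun u => ?_)
      · rw [mem_support_iff, coeff_mul_monomial, mul_one]
        exact mem_support_iff.1 hc
      · rw [Finsupp.add_apply, ha]
        by_cases hu : u ∈ P
        · rw [hcP u hu]
          have := hbs u
          omega
        · rw [hbP u hu]
          exact Nat.zero_le _

theorem exists_eq_monomialPrime_of_mem_associatedPrimes [Finite V] {s : ℕ}
    {Q : Ideal (MvPolynomial V k)}
    (hQ : Q ∈ associatedPrimes (MvPolynomial V k) (MvPolynomial V k ⧸ G.coverIdeal k ^ s)) :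
    ∃ P : Finset V, Q = monomialPrime k P := by
  rw [coverIdeal_pow_eq_span] at hQ
  exact exists_eq_monomialPrime hQ

/-! ### Cliques and associated primes -/

section

variable [Fintype V] [DecidableEq V] {s : ℕ} {P : Finset V}

/-- In any graph a clique with `1 < |P| ≤ s + 1` gives an associated prime: a positive weight on it
of total `s + 1` is critical. -/
theorem IsClique.monomialPrime_mem_associatedPrimes (hP : G.IsClique (P : Set V))
    (h1 : 1 < P.card) (hs : P.card ≤ s + 1) :
    monomialPrime k P ∈
      associatedPrimes (MvPolynomial V k) (MvPolynomial V k ⧸ G.coverIdeal k ^ s) := by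
  rw [monomialPrime_mem_associatedPrimes_iff]
  obtain ⟨x, hx⟩ : P.Nonempty := Finset.card_pos.1 (by omega)
  let b : V → ℕ := fun v => if v ∈ P then 1 + (if v = x then s + 1 - P.card else 0) else 0
  have hbP : ∀ v ∈ P, b v = 1 + (if v = x then s + 1 - P.card else 0) := fun v hv => if_pos hv
  have hb0 : ∀ v ∉ P, b v = 0 := fun v hv => if_neg hv
  have hsum : ∑ v ∈ P, b v = s + 1 := by
    rw [Finset.sum_congr rfl hbP, Finset.sum_add_distrib, Finset.sum_ite_eq' P x, if_pos hx]
    simp only [Finset.sum_const, smul_eq_mul, mul_one]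
    omega
  refine ⟨b, fun v => ?_, hb0, fun h => ?_, fun v hv => ?_⟩
  · by_cases hv : v ∈ P
    · rw [hbP v hv]
      split_ifs <;> omega
    · rw [hb0 v hv]
      exact Nat.zero_le _
  · have := h.sum_le hP
    omega
  · refine isMulticolorable_of_sum_le (P := P) (fun u hu => by simp [hb0 u hu]) ?_
    have : ∑ u ∈ P, (b u - if u = v then 1 else 0) < ∑ u ∈ P, b u := by
      refine Finset.sum_lt_sum (fun u _ => Nat.sub_le _ _) ⟨v, hv, ?_⟩
      rw [hbP v hv, if_pos rfl]
      omega
    omega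

/-- On a perfect part of the graph, a critical weight lives on a clique, because only cliques
obstruct multicolorings there. -/
theorem IsPerfectOn.isClique_of_mem_associatedPrimes (hG : G.IsPerfectOn P)
    (h : monomialPrime k P ∈
      associatedPrimes (MvPolynomial V k) (MvPolynomial V k ⧸ G.coverIdeal k ^ s)) :
    G.IsClique (P : Set V) ∧ 1 < P.card ∧ P.card ≤ s + 1 := by
  obtain ⟨b, hbs, hb0, hb, hbv⟩ := monomialPrime_mem_associatedPrimes_iff.1 h
  have hK : ∃ K : Finset V, G.IsClique (K : Set V) ∧ s < ∑ v ∈ K, b v := by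
    by_contra! hK
    exact hb (hG.isMulticolorable b hb0 s hK)
  obtain ⟨K, hK, hsK⟩ := hK
  have hpos : ∀ v ∈ P, b v ≠ 0 := fun v hv h0 => hb ((hbv v hv).mono fun u => by
    by_cases huv : u = v
    · subst huv; simp [h0]
    · simp [huv])
  have hPK : P ⊆ K := by
    intro v hv
    by_contra hvK
    refine hsK.not_ge (le_trans (Finset.sum_le_sum fun u hu => ?_) ((hbv v hv).sum_le hK))
    have huv : u ≠ v := by
      rintro rfl
      exact hvK hu
    rw [if_neg huv, Nat.sub_zero]
  have hPc : G.IsClique (P : Set V) := hK.subset (by exact_mod_cast hPK)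
  have hsP : s < ∑ v ∈ P, b v := by
    rwa [Finset.sum_subset hPK fun v _ hv => hb0 v hv]
  have hne : P.Nonempty := by
    by_contra hP
    rw [Finset.not_nonempty_iff_eq_empty.1 hP] at hsP
    simp at hsP
  obtain ⟨x, hx⟩ := hne
  refine ⟨hPc, ?_, ?_⟩
  · by_contra! h1
    have hPx : P = {x} := Finset.eq_singleton_iff_unique_mem.2
      ⟨hx, fun y hy => Finset.card_le_one.1 h1 y hy x hx⟩
    rw [hPx, Finset.sum_singleton] at hsP
    have := hbs x
    omega
  · have h1 := (hbv x hx).sum_le hPc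
    have h2 : ∑ u ∈ P, b u ≤ ∑ u ∈ P, ((b u - if u = x then 1 else 0) +
        if u = x then 1 else 0) := Finset.sum_le_sum fun u _ => by omega
    rw [Finset.sum_add_distrib, Finset.sum_ite_eq' P x, if_pos hx] at h2
    have h3 : P.card ≤ ∑ u ∈ P, b u := by
      rw [Finset.card_eq_sum_ones]
      exact Finset.sum_le_sum fun u hu => Nat.one_le_iff_ne_zero.2 (hpos u hu)
    omega

/-- The saturated chain property holds once all associated primes come from cliques: a clique
with a vertex removed is again a clique, and edges give minimal primes. -/
theorem saturatedChainProperty_of_isClique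
    (h : ∀ P : Finset V, monomialPrime k P ∈
        associatedPrimes (MvPolynomial V k) (MvPolynomial V k ⧸ G.coverIdeal k ^ s) →
      G.IsClique (P : Set V) ∧ 1 < P.card ∧ P.card ≤ s + 1) :
    (G.coverIdeal k ^ s).SaturatedChainProperty := by
  intro Q hQ hmin
  obtain ⟨P, rfl⟩ := exists_eq_monomialPrime_of_mem_associatedPrimes hQ
  obtain ⟨hP, h1, hPs⟩ := h P hQ
  have h2 : 2 < P.card := by
    by_contra! h2
    refine hmin ⟨hQ, fun Q' hQ' hle => ?_⟩
    obtain ⟨P', rfl⟩ := exists_eq_monomialPrime_of_mem_associatedPrimes hQ'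
    obtain ⟨-, h1', -⟩ := h P' hQ'
    rw [monomialPrime_le_iff] at hle ⊢
    exact (Finset.eq_of_subset_of_card_le hle (by omega)).ge
  obtain ⟨x, hx⟩ : P.Nonempty := Finset.card_pos.1 (by omega)
  have hcard := Finset.card_erase_add_one hx
  refine ⟨monomialPrime k (P.erase x), ?_, monomialPrime_lt_iff.2 (Finset.erase_ssubset hx), ?_⟩
  · refine IsClique.monomialPrime_mem_associatedPrimes (hP.subset ?_) (by omega) (by omega)
    exact_mod_cast Finset.erase_subset _ _
  · rw [monomialPrime_height, monomialPrime_height]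
    exact_mod_cast hcard

/-- A minimal imperfect set `T`, with `s` a bound for its cliques that is not attained by a coloring,
gives an associated prime of `J ^ s`, its indicator being a critical weight: each `T \ {v}` is perfect
and hence `s`-colorable. -/
theorem exists_associatedPrime_of_not_isPerfectGraph (hG : ¬ G.IsPerfectGraph) :
    ∃ (s : ℕ) (T : Finset V), 1 ≤ s ∧ (s : ℕ∞) < G.chromaticNumber ∧
      (∃ u ∈ T, ∃ v ∈ T, G.Adj u v) ∧ (∀ K ⊆ T, G.IsClique (K : Set V) → K.card ≤ s) ∧
      ¬ G.IsMulticolorable (fun v => if v ∈ T then 1 else 0) s ∧ (∀ S ⊂ T, G.IsPerfectOn S) ∧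
      monomialPrime k T ∈ associatedPrimes (MvPolynomial V k) (MvPolynomial V k ⧸ G.coverIdeal k ^ s) := by
  obtain ⟨T, s, hs, hT, hmin⟩ := exists_minimal_of_not_isPerfectGraph hG
  have hne : T.Nonempty := by
    by_contra hne
    rw [Finset.not_nonempty_iff_eq_empty.1 hne] at hT
    exact hT ⟨fun _ => ∅, fun j => by simp [IsIndepSet], fun v => by simp⟩
  obtain ⟨x, hx⟩ := hne
  have h1s : 1 ≤ s := by
    simpa using hs {x} (Finset.singleton_subset_iff.2 hx) (by simp)
  refine ⟨s, T, h1s, ?_, ?_, hs, hT, hmin, ?_⟩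
  · rw [lt_iff_not_ge, chromaticNumber_le_iff_colorable]
    intro hc
    exact hT (isMulticolorable_indicator_iff.2 (hc.of_hom (Embedding.induce _).toHom))
  · by_contra! hind
    refine hT ⟨fun _ => T, fun j u hu v hv _ => hind u hu v hv, fun v => ?_⟩
    by_cases hv : v ∈ T
    · simpa [hv] using h1s
    · simp [hv]
  · rw [monomialPrime_mem_associatedPrimes_iff]
    refine ⟨_, fun v => ?_, fun v hv => if_neg hv, hT, fun v hv => ?_⟩
    · split_ifs <;> omega
    · refine (hmin (T.erase v) (Finset.erase_ssubset hv) _ subset_rfl s fun K hK =>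
        hs K (hK.trans (Finset.erase_subset _ _))).mono fun u => ?_
      by_cases huv : u = v
      · subst huv
        simp [hv]
      · simp [huv]

/-- In the absence of perfection, the saturated chain property fails for the prime of a minimal
imperfect set `T`: an associated prime one step below would come from a clique of `|T| - 1` vertices,
so that `|T| - 1 ≤ s`, and `T`, having two vertices that are not adjacent, would be `s`-colorable. -/
theorem isPerfectGraph_of_saturatedChainProperty
    (h : ∀ s : ℕ, 1 ≤ s → (G.coverIdeal k ^ s).SaturatedChainProperty) : G.IsPerfectGraph := by
  by_contra hG
  obtain ⟨s, T, h1s, -, ⟨u, hu, v, hv, huv⟩, hs, hT, hmin, hass⟩ :=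
    exists_associatedPrime_of_not_isPerfectGraph (k := k) hG
  have hTc : ¬ G.IsClique (T : Set V) := fun hTc => hT
    (isMulticolorable_of_sum_le (P := T) (fun v hv => if_neg hv)
      (by simpa using hs T subset_rfl hTc))
  have hpair : G.IsClique (({u, v} : Finset V) : Set V) := by
    simpa [isClique_pair] using fun _ => huv
  have hsub : ({u, v} : Finset V) ⊂ T := by
    refine Finset.ssubset_iff_subset_ne.2 ⟨?_, fun h => hTc (h ▸ hpair)⟩
    simp [Finset.insert_subset_iff, hu, hv]
  have hcard2 : ({u, v} : Finset V).card = 2 := Finset.card_pair huv.ne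
  obtain ⟨Q, hQ, hlt, hht⟩ := h s h1s _ hass fun hm => by
    have := hm.2 (hpair.monomialPrime_mem_associatedPrimes (k := k) (s := s) (by omega)
      (by omega)) (monomialPrime_lt_iff.2 hsub).le
    exact (monomialPrime_lt_iff.2 hsub).not_ge this
  obtain ⟨C, rfl⟩ := exists_eq_monomialPrime_of_mem_associatedPrimes hQ
  rw [monomialPrime_lt_iff] at hlt
  rw [monomialPrime_height, monomialPrime_height] at hht
  have hcard : C.card + 1 = T.card := by exact_mod_cast hht
  obtain ⟨hC, -, -⟩ := (hmin C hlt).isClique_of_mem_associatedPrimes hQ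
  have hCs := hs C hlt.subset hC
  -- Two non-adjacent vertices of `T` share a color, the others get a color each.
  obtain ⟨x, hx, y, hy, hxy, hadj⟩ : ∃ x ∈ T, ∃ y ∈ T, x ≠ y ∧ ¬ G.Adj x y := by
    by_contra! hall
    exact hTc fun x hx y hy hne => hall x hx y hy hne
  have hind : G.IsIndepSet (({x, y} : Finset V) : Set V) := by
    simp [IsIndepSet, Set.pairwise_pair, hadj, G.adj_comm y x]
  obtain ⟨m, rfl⟩ : ∃ m, s = m + 1 := ⟨s - 1, by omega⟩
  refine hT (IsMulticolorable.cons (c := fun v => if v ∈ T \ {x, y} then 1 else 0)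
    (isMulticolorable_of_sum_le (P := T \ {x, y}) (fun v hv => if_neg hv) ?_) hind fun v => ?_)
  · have hxyT : ({x, y} : Finset V) ⊆ T := by simp [Finset.insert_subset_iff, hx, hy]
    have := Finset.card_sdiff_of_subset hxyT
    have h2 := Finset.card_pair hxy
    rw [Finset.sum_ite_mem, Finset.inter_self, Finset.sum_const, smul_eq_mul, mul_one]
    omega
  · by_cases hvT : v ∈ T <;> by_cases hvx : v ∈ ({x, y} : Finset V) <;> simp [hvT, hvx]

end

end SimpleGraph

theorem theorem5 {V : Type*} [Finite V] (G : SimpleGraph V) (k : Type*) [Field k] :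
    List.TFAE [
      G.IsPerfectGraph,
      ∀ s : ℕ, 1 ≤ s → ∀ P : Finset V,
        monomialPrime k P ∈
            associatedPrimes (MvPolynomial V k) (MvPolynomial V k ⧸ G.coverIdeal k ^ s) ↔
          G.IsClique (P : Set V) ∧ 1 < P.card ∧ P.card ≤ s + 1,
      ∀ s : ℕ, 1 ≤ s → (s : ℕ∞) < G.chromaticNumber → ∀ P : Finset V,
        monomialPrime k P ∈
            associatedPrimes (MvPolynomial V k) (MvPolynomial V k ⧸ G.coverIdeal k ^ s) ↔
          G.IsClique (P : Set V) ∧ 1 < P.card ∧ P.card ≤ s + 1,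
      ∀ s : ℕ, 1 ≤ s → (G.coverIdeal k ^ s).SaturatedChainProperty] := by
  classical
  cases nonempty_fintype V
  tfae_have 1 → 2 := fun hG s _ P =>
    ⟨fun h => (hG.isPerfectOn P).isClique_of_mem_associatedPrimes h,
      fun ⟨hP, h1, hs⟩ => hP.monomialPrime_mem_associatedPrimes h1 hs⟩
  tfae_have 2 → 3 := fun h s hs _ => h s hs
  tfae_have 3 → 1 := fun h => by
    by_contra hG
    obtain ⟨s, T, h1s, hsχ, -, hs, hT, -, hass⟩ :=
      SimpleGraph.exists_associatedPrime_of_not_isPerfectGraph (k := k) hG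
    obtain ⟨hTc, -, -⟩ := (h s h1s hsχ T).1 hass
    exact hT (SimpleGraph.isMulticolorable_of_sum_le (P := T) (fun v hv => if_neg hv)
      (by simpa using hs T subset_rfl hTc))
  tfae_have 2 → 4 := fun h s hs =>
    SimpleGraph.saturatedChainProperty_of_isClique fun P hP => (h s hs P).1 hP
  tfae_have 4 → 1 := SimpleGraph.isPerfectGraph_of_saturatedChainProperty
  tfae_finish
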